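/- Let $n\ge 1$ and $0\le\alpha<n$. For a Lebesgue measurable function $p:\mathbb R^n\to[1,\infty]$ (an exponent) let $p_-=\operatorname{ess\,inf}_{\mathbb R^n}p$ and $\Omega_\infty=\{x: p(x)=\infty\}$, and for a measurable function $f$ put $$\rho_{p(\cdot)}(f)=\int_{\mathbb R^n\setminus\Omega_\infty}|f(x)|^{p(x)}\,dx+\|f\|_{L^\infty(\Omega_\infty)},\qquad \|f\|_{p(\cdot)}=\inf\{\lambda>0:\rho_{p(\cdot)}(f/\lambda)\le 1\},$$ with $\inf\emptyset=\infty$. Let $L^{p(\cdot)}(\mathbb R^n)$ be the set of measurable $f$ with $\rho_{p(\cdot)}(f/\lambda)<\infty$ for some $\lambda>0$. Let $$M_\alpha f(x)=\sup_{Q}|Q|^{\frac{\alpha}{n}}\,\frac1{|Q|}\int_Q|f(y)|\,dy,$$ where the supremum is over all cubes $Q$ centered at $x$ with sides parallel to the coordinate axes. Let $p,q:\mathbb R^n\to[1,\infty]$ be exponents with $$\frac1{p(x)}-\frac1{q(x)}=\frac{\alpha}{n}\qquad\text{for almost every }x\in\mathbb R^n,$$ where $1/\infty=0$ (so that necessarily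 $p\le n/\alpha$ almost everywhere if $\alpha>0$). If there is a constant $C<\infty$ such that $$\|M_\alpha f\|_{q(\cdot)}\le C\,\|f\|_{p(\cdot)}\qquad\text{for all } f\in L^{p(\cdot)}(\mathbb R^n),$$ then $p_->1$. -/

import Mathlib

open MeasureTheory Set
open scoped ENNReal NNReal

noncomputable section

namespace VarLebesgue

/-- `p` is an exponent function on `ℝⁿ`: a Lebesgue measurable function with values in `[1, ∞]`. -/
structure IsExponent {n : ℕ} (p : (Fin n → ℝ) → ℝ≥0∞) : Prop where
  aemeasurable : AEMeasurable p volume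
  one_le : ∀ x, 1 ≤ p x

/-- The modular `∫_{p < ∞} g(x)^{p(x)} dx + ‖g‖_{L^∞({p = ∞})}` of a nonnegative function `g`
with values in `[0, ∞]`. The modular of a real function `f` is the modular of `|f|`. -/
def modular {n : ℕ} (p : (Fin n → ℝ) → ℝ≥0∞) (g : (Fin n → ℝ) → ℝ≥0∞) : ℝ≥0∞ :=
  (∫⁻ x in {x | p x ≠ ⊤}, g x ^ (p x).toReal) + essSup g (volume.restrict {x | p x = ⊤})

/-- The Luxemburg norm `inf {c > 0 : ρ_p(g / c) ≤ 1}` of a nonnegative function `g`; it is `∞`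
when there is no such `c`. -/
def luxNorm {n : ℕ} (p : (Fin n → ℝ) → ℝ≥0∞) (g : (Fin n → ℝ) → ℝ≥0∞) : ℝ≥0∞ :=
  ⨅ (c : ℝ≥0) (_ : 0 < c) (_ : modular p (fun x => g x / c) ≤ 1), (c : ℝ≥0∞)

/-- Membership in the variable Lebesgue space `L^{p(·)}(ℝⁿ)`: `f` is Lebesgue measurable and
`ρ_p(f / c) < ∞` for some `c > 0`. -/
def MemVarLp {n : ℕ} (p : (Fin n → ℝ) → ℝ≥0∞) (f : (Fin n → ℝ) → ℝ) : Prop :=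
  AEMeasurable f volume ∧ ∃ c : ℝ≥0, 0 < c ∧ modular p (fun x => ‖f x‖ₑ / c) < ⊤

/-- The cube with center `x`, side length `2 r` and sides parallel to the coordinate axes. -/
def cube {n : ℕ} (x : Fin n → ℝ) (r : ℝ) : Set (Fin n → ℝ) :=
  {y | ∀ i, |y i - x i| ≤ r}

/-- The fractional maximal function
`M_α f (x) = sup_Q |Q|^{α/n} (1/|Q|) ∫_Q |f|`, the supremum over the cubes `Q` centered at `x`. -/
def fracMaximal {n : ℕ} (α : ℝ) (f : (Fin n → ℝ) → ℝ) (x : Fin n → ℝ) : ℝ≥0∞ :=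
  ⨆ (r : ℝ) (_ : 0 < r),
    volume (cube x r) ^ (α / n) * ((volume (cube x r))⁻¹ * ∫⁻ y in cube x r, ‖f y‖ₑ)

/-- The operator `T`, with values in the nonnegative functions, satisfies the strong
`(p(·), q(·))` inequality: `‖T f‖_{q(·)} ≤ C ‖f‖_{p(·)}` for all `f ∈ L^{p(·)}`, with a finite
constant `C` that does not depend on `f`. -/
def StrongBounded {n : ℕ} (p q : (Fin n → ℝ) → ℝ≥0∞)
    (T : ((Fin n → ℝ) → ℝ) → (Fin n → ℝ) → ℝ≥0∞) : Prop :=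
  ∃ C : ℝ≥0, ∀ f : (Fin n → ℝ) → ℝ, MemVarLp p f →
    luxNorm q (T f) ≤ C * luxNorm p (fun x => ‖f x‖ₑ)

end VarLebesgue

end

/-! ### The extremal mass of a set for the `p`-modular. -/

namespace VarLebesgue

/-! Suppose `p_- ≤ 1`, and let `E` be a set of positive measure on which `p ≤ 1 + ε`. Around a
density point of `E` take dyadic balls `B_i` of volume `V_i`, and let `T_i` be the extremal mass of
`E ∩ B_i`. No regularity of `p` is available; extremality replaces it.

Since `p` is close to `1`, `T_i` decays at most like `V_i ^ ε`, so it loses at most a factor `2`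
over some block of `N` scales (`exists_massSup_le_two_mul`). One near-extremal `f` for the smallest
ball of the block is then nearly extremal at every scale of it, and on each shell `M_α f` is at
least a constant times `V_i ^ (α/n - 1) * T_i`. By extremality of `T_i`, nine times that quantity
has `q`-modular at least `1` on the shell (`one_le_setLIntegral_rpow`). The disjoint shells
contribute a total of order `N`, whereas boundedness keeps the modular of `M_α f / (C + 1)` at most
`1`. -/

/-- The largest mass of a function supported in `A` whose `p`-modular over `E` is at most `1`. -/
noncomputable def massSup {n : ℕ} (p : (Fin n → ℝ) → ℝ≥0∞) (E A : Set (Fin n → ℝ)) : ℝ≥0∞ :=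
  ⨆ (f : (Fin n → ℝ) → ℝ) (_ : Measurable f) (_ : Function.support f ⊆ A)
    (_ : ∫⁻ x in E, ‖f x‖ₑ ^ (p x).toReal ≤ 1), ∫⁻ x, ‖f x‖ₑ

variable {n : ℕ} {p q : (Fin n → ℝ) → ℝ≥0∞} {E A S : Set (Fin n → ℝ)}

lemma massSup_mono {A' : Set (Fin n → ℝ)} (h : A ⊆ A') : massSup p E A ≤ massSup p E A' := by
  refine iSup_le fun f => iSup_le fun hf => iSup_le fun hs => iSup_le fun hm => ?_
  exact le_iSup_of_le f (le_iSup_of_le hf (le_iSup_of_le (hs.trans h)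
    (le_iSup_of_le hm le_rfl)))

lemma exists_of_lt_massSup {t : ℝ≥0∞} (h : t < massSup p E A) :
    ∃ f : (Fin n → ℝ) → ℝ, Measurable f ∧ Function.support f ⊆ A ∧
      ∫⁻ x in E, ‖f x‖ₑ ^ (p x).toReal ≤ 1 ∧ t < ∫⁻ x, ‖f x‖ₑ := by
  simp only [massSup, lt_iSup_iff] at h
  obtain ⟨f, hf, hs, hm, ht⟩ := h
  exact ⟨f, hf, hs, hm, ht⟩

lemma massSup_le (hAE : A ⊆ E) (hA : MeasurableSet A) (hp : ∀ x ∈ E, 1 ≤ (p x).toReal) :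
    massSup p E A ≤ volume A + 1 := by
  refine iSup_le fun f => iSup_le fun hf => iSup_le fun hs => iSup_le fun hm => ?_
  have h0 : ∫⁻ x, ‖f x‖ₑ = ∫⁻ x in A, ‖f x‖ₑ := by
    refine (setLIntegral_eq_of_support_subset ?_).symm
    intro x hx
    exact hs (by simpa using hx)
  rw [h0]
  calc ∫⁻ x in A, ‖f x‖ₑ ≤ ∫⁻ x in A, (1 + ‖f x‖ₑ ^ (p x).toReal) := by
        refine setLIntegral_mono' hA fun x hx => ?_
        rcases le_total ‖f x‖ₑ 1 with h | h
        · exact h.trans le_self_add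
        · calc ‖f x‖ₑ = ‖f x‖ₑ ^ (1 : ℝ) := (ENNReal.rpow_one _).symm
            _ ≤ ‖f x‖ₑ ^ (p x).toReal := ENNReal.rpow_le_rpow_of_exponent_le h (hp x (hAE hx))
            _ ≤ _ := le_add_self
    _ = volume A + ∫⁻ x in A, ‖f x‖ₑ ^ (p x).toReal := by
        rw [lintegral_add_left measurable_const]; simp
    _ ≤ volume A + 1 := by
        gcongr
        exact (lintegral_mono_set hAE).trans hm

lemma const_mul_volume_le_massSup (hSE : S ⊆ E) (hSA : S ⊆ A) (hS : MeasurableSet S)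
    (hE : MeasurableSet E)
    (hp : ∀ x ∈ E, 1 ≤ (p x).toReal) {c : ℝ≥0∞} (hc : c ≠ ⊤)
    (hm : ∫⁻ x in S, c ^ (p x).toReal ≤ 1) : c * volume S ≤ massSup p E A := by
  have hn : ∀ x, ‖S.indicator (fun _ => c.toReal) x‖ₑ = S.indicator (fun _ => c) x := by
    intro x
    by_cases hx : x ∈ S
    · simp [hx, Real.enorm_eq_ofReal, ENNReal.ofReal_toReal hc]
    · simp [hx]
  refine le_iSup_of_le (S.indicator fun _ => c.toReal) (le_iSup_of_le
    (measurable_const.indicator hS) (le_iSup_of_le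
    (Set.support_indicator_subset.trans hSA) (le_iSup_of_le ?_ ?_)))
  · calc ∫⁻ x in E, ‖S.indicator (fun _ => c.toReal) x‖ₑ ^ (p x).toReal
        = ∫⁻ x in E, S.indicator (fun x => c ^ (p x).toReal) x := by
          refine setLIntegral_congr_fun hE fun x hx => ?_
          simp only [hn]
          by_cases hxS : x ∈ S
          · simp [hxS]
          · simp [hxS, ENNReal.zero_rpow_of_pos (zero_lt_one.trans_le (hp x hx))]
      _ = ∫⁻ x in S, c ^ (p x).toReal := by
          rw [setLIntegral_indicator hS, inter_eq_left.2 hSE]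
      _ ≤ 1 := hm
  · simp only [hn]
    rw [lintegral_indicator_const hS]

/-- The constant `|A| ^ (-1/(1+ε))` on `A` is admissible and has mass `|A| ^ (ε/(1+ε))`. This is
where `p` near `1` gives slow decay. -/
lemma rpow_volume_le_massSup {ε : ℝ} (hε : 0 < ε) (hAE : A ⊆ E) (hA : MeasurableSet A)
    (hE : MeasurableSet E)
    (hp : ∀ x ∈ E, 1 ≤ (p x).toReal) (hp' : ∀ x ∈ E, (p x).toReal ≤ 1 + ε)
    (hA0 : volume A ≠ 0) (hA1 : volume A ≤ 1) : volume A ^ ε ≤ massSup p E A := by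
  have hAt : volume A ≠ ⊤ := ne_top_of_le_ne_top ENNReal.one_ne_top hA1
  have h1ε : (0 : ℝ) < 1 + ε := by linarith
  have hc1 : 1 ≤ volume A ^ (-(1 + ε)⁻¹) :=
    ENNReal.one_le_rpow_of_pos_of_le_one_of_neg hA0.bot_lt hA1 (by simpa using h1ε)
  have key := const_mul_volume_le_massSup (p := p) (A := A) hAE subset_rfl hA hE hp
    (c := volume A ^ (-(1 + ε)⁻¹)) (ENNReal.rpow_ne_top_of_ne_zero hA0 hAt) (by
      calc ∫⁻ x in A, (volume A ^ (-(1 + ε)⁻¹)) ^ (p x).toReal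
          ≤ ∫⁻ x in A, (volume A)⁻¹ := by
            refine setLIntegral_mono' hA fun x hx => ?_
            refine (ENNReal.rpow_le_rpow_of_exponent_le hc1 (hp' x (hAE hx))).trans_eq ?_
            rw [← ENNReal.rpow_mul, neg_mul, inv_mul_cancel₀ h1ε.ne', ENNReal.rpow_neg_one]
        _ = (volume A)⁻¹ * volume A := by simp
        _ ≤ 1 := ENNReal.inv_mul_le_one _)
  refine le_trans ?_ key
  calc volume A ^ ε ≤ volume A ^ (-(1 + ε)⁻¹ + 1) := by
        refine ENNReal.rpow_le_rpow_of_exponent_ge hA1 ?_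
        have : 1 - ε ≤ (1 + ε)⁻¹ := by
          rw [← one_div, le_div_iff₀ h1ε]
          nlinarith
        linarith
    _ = _ := by rw [ENNReal.rpow_add _ _ hA0 hAt, ENNReal.rpow_one]

lemma massSup_ne_zero (hAE : A ⊆ E) (hA : MeasurableSet A) (hE : MeasurableSet E)
    (hp : ∀ x ∈ E, 1 ≤ (p x).toReal) (hA0 : volume A ≠ 0) (hAt : volume A ≠ ⊤) :
    massSup p E A ≠ 0 := by
  have key := const_mul_volume_le_massSup (p := p) (A := A) hAE subset_rfl hA hE hp
    (c := min 1 (volume A)⁻¹) (by simp) (by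
      calc ∫⁻ x in A, (min 1 (volume A)⁻¹) ^ (p x).toReal
          ≤ ∫⁻ x in A, (volume A)⁻¹ := by
            refine setLIntegral_mono' hA fun x hx => ?_
            refine (ENNReal.rpow_le_rpow_of_exponent_ge (min_le_left _ _)
              (hp x (hAE hx))).trans ?_
            rw [ENNReal.rpow_one]
            exact min_le_right _ _
        _ = (volume A)⁻¹ * volume A := by simp
        _ ≤ 1 := ENNReal.inv_mul_le_one _)
  have hc : min 1 (volume A)⁻¹ ≠ 0 :=
    (lt_min one_pos (ENNReal.inv_pos.2 hAt)).ne'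
  exact ((pos_iff_ne_zero.2 (mul_ne_zero hc hA0)).trans_le key).ne'

/-- Otherwise, with `s` the integrand's base, the constant `s * V ^ (-a) / 2` on `S` would be
admissible for `T = massSup p E A`, yet its mass is at least `9 T / 8`; any factor above `8` would
do in place of `9`. -/
lemma one_le_setLIntegral_rpow {a : ℝ} (ha : 0 ≤ a) (hSE : S ⊆ E) (hSA : S ⊆ A)
    (hAE : A ⊆ E) (hS : MeasurableSet S) (hA : MeasurableSet A) (hE : MeasurableSet E)
    (hp : ∀ x ∈ E, 1 ≤ (p x).toReal) (hq : ∀ x ∈ E, 0 < (q x).toReal)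
    (hpq : ∀ x ∈ E, (p x).toReal⁻¹ = (q x).toReal⁻¹ + a)
    {V : ℝ≥0∞} (hV0 : V ≠ 0) (hVt : V ≠ ⊤) (hSV : volume S ≤ V) (hVS : V ≤ 4 * volume S)
    (hAt : volume A ≠ ⊤) (hT : massSup p E A ≠ 0) :
    1 ≤ ∫⁻ x in S, (9 * (V ^ (a - 1) * massSup p E A)) ^ (q x).toReal := by
  by_contra! hlt
  set T := massSup p E A with hTdef
  have hTt : T ≠ ⊤ := ne_top_of_le_ne_top (by simp [hAt]) (massSup_le hAE hA hp)
  set s : ℝ≥0∞ := 9 * (V ^ (a - 1) * T) with hs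
  have hst : s ≠ ⊤ := by
    refine ENNReal.mul_ne_top (by simp) (ENNReal.mul_ne_top ?_ hTt)
    exact ENNReal.rpow_ne_top_of_ne_zero hV0 hVt
  have hVa : V ^ (-a) ≠ ⊤ := ENNReal.rpow_ne_top_of_ne_zero hV0 hVt
  have hpt : ∀ x ∈ S, (2⁻¹ * (s * V ^ (-a))) ^ (p x).toReal ≤
      2⁻¹ * (s ^ (q x).toReal + V⁻¹) := by
    intro x hx
    have hx := hSE hx
    have hp0 : 0 < (p x).toReal := zero_lt_one.trans_le (hp x hx)
    rw [ENNReal.mul_rpow_of_nonneg _ _ hp0.le]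
    gcongr
    · calc (2⁻¹ : ℝ≥0∞) ^ (p x).toReal ≤ 2⁻¹ ^ (1 : ℝ) :=
          ENNReal.rpow_le_rpow_of_exponent_ge (by simp) (hp x hx)
        _ = 2⁻¹ := ENNReal.rpow_one _
    -- A Young-type bound: `s ≤ h ^ (1/q)` and `V ^ (-a) ≤ h ^ a`, and the exponents add up to
    -- `1/p`.
    · set h := s ^ (q x).toReal + V⁻¹ with hh
      have h1 : s ≤ h ^ (q x).toReal⁻¹ := by
        rw [ENNReal.le_rpow_inv_iff (hq x hx)]
        exact le_self_add
      have h2 : V ^ (-a) ≤ h ^ a := by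
        rw [ENNReal.rpow_neg, ← ENNReal.inv_rpow]
        exact ENNReal.rpow_le_rpow le_add_self ha
      rw [← ENNReal.le_rpow_inv_iff hp0, hpq x hx,
        ENNReal.rpow_add_of_nonneg _ _ (inv_nonneg.2 (hq x hx).le) ha]
      exact mul_le_mul' h1 h2
  have key := const_mul_volume_le_massSup (p := p) hSE hSA hS hE hp
    (c := 2⁻¹ * (s * V ^ (-a))) (ENNReal.mul_ne_top (by simp) (ENNReal.mul_ne_top hst hVa)) (by
      calc ∫⁻ x in S, (2⁻¹ * (s * V ^ (-a))) ^ (p x).toReal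
          ≤ ∫⁻ x in S, 2⁻¹ * (s ^ (q x).toReal + V⁻¹) := setLIntegral_mono' hS hpt
        _ = 2⁻¹ * ((∫⁻ x in S, s ^ (q x).toReal) + V⁻¹ * volume S) := by
          rw [lintegral_const_mul' _ _ (by simp), lintegral_add_right _ measurable_const]
          simp
        _ ≤ 2⁻¹ * (1 + 1) := by
          gcongr
          rw [mul_comm, ← div_eq_mul_inv]
          exact ENNReal.div_le_of_le_mul (by simpa using hSV)
        _ = 1 := by rw [one_add_one_eq_two]; exact ENNReal.inv_mul_cancel (by simp) (by simp))
  rw [← hTdef] at key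
  have hVV : V ^ (a - 1) * V ^ (-a) * V = 1 := by
    rw [← ENNReal.rpow_add _ _ hV0 hVt]
    conv_lhs => rw [← ENNReal.rpow_one V]
    rw [← ENNReal.rpow_mul, ← ENNReal.rpow_add _ _ hV0 hVt]
    ring_nf
    simp
  have h9 : 9 * T ≤ 8 * T := by
    calc 9 * T = 9 * T * (V ^ (a - 1) * V ^ (-a) * V) := by rw [hVV, mul_one]
      _ = s * V ^ (-a) * V := by rw [hs]; ring
      _ ≤ s * V ^ (-a) * (4 * volume S) := by gcongr
      _ = 4 * (2 * 2⁻¹) * (s * V ^ (-a)) * volume S := by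
        rw [ENNReal.mul_inv_cancel (by simp) (by simp)]; ring
      _ = 8 * (2⁻¹ * (s * V ^ (-a)) * volume S) := by ring
      _ ≤ 8 * T := by gcongr
  rw [ENNReal.mul_le_mul_iff_left hT hTt] at h9
  norm_num at h9

lemma exists_half_le_succ {t : ℕ → ℝ} {κ ρ : ℝ} (hκ : 0 < κ) (hρ : 1 / 2 < ρ)
    (h : ∀ k, κ * ρ ^ k ≤ t k) : ∃ k, t k / 2 ≤ t (k + 1) := by
  by_contra! hlt
  have hle : ∀ k, t k ≤ t 0 * (1 / 2) ^ k := by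
    intro k
    induction k with
    | zero => simp
    | succ k ih => rw [pow_succ]; linarith [hlt k]
  have hb : ∀ k, κ ≤ t 0 * (1 / 2 / ρ) ^ k := by
    intro k
    rw [div_pow, ← mul_div_assoc, le_div_iff₀ (by positivity)]
    exact (h k).trans (hle k)
  have hlim : Filter.Tendsto (fun k => t 0 * (1 / 2 / ρ) ^ k) Filter.atTop (nhds (t 0 * 0)) :=
    (tendsto_pow_atTop_nhds_zero_of_lt_one (by positivity)
      ((div_lt_one (by linarith)).2 hρ)).const_mul _
  have := ge_of_tendsto' hlim hb
  simp at this
  linarith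

end VarLebesgue

/-! ### Bounds for the maximal function and the modulars; choice of `E` and of the density point. -/

namespace VarLebesgue

variable {n : ℕ} {p q : (Fin n → ℝ) → ℝ≥0∞} {E : Set (Fin n → ℝ)}

lemma cube_eq_closedBall (x : Fin n → ℝ) {r : ℝ} (hr : 0 ≤ r) :
    cube x r = Metric.closedBall x r := by
  ext y
  simp [cube, dist_pi_le_iff hr, Real.dist_eq]

lemma le_fracMaximal {α : ℝ} (hα : 0 ≤ α) {f : (Fin n → ℝ) → ℝ} {x₀ x : Fin n → ℝ} {r : ℝ}
    (hr : 0 < r) (hx : x ∈ Metric.closedBall x₀ r)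
    (hf : Function.support f ⊆ Metric.closedBall x₀ r) :
    (2 ^ n)⁻¹ * (volume (Metric.closedBall x₀ r) ^ (α / n - 1) * ∫⁻ y, ‖f y‖ₑ) ≤
      fracMaximal α f x := by
  set V := volume (Metric.closedBall x₀ r) with hV
  have hV0 : V ≠ 0 := (Metric.measure_closedBall_pos _ _ hr).ne'
  have hVt : V ≠ ⊤ := measure_closedBall_lt_top.ne
  have h2r : volume (cube x (2 * r)) = 2 ^ n * V := by
    rw [cube_eq_closedBall x (by positivity), hV, Real.volume_pi_closedBall _ (by positivity),
      Real.volume_pi_closedBall _ hr.le, Fintype.card_fin, mul_pow 2 (2 * r),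
      ENNReal.ofReal_mul (by positivity), ENNReal.ofReal_pow (by norm_num)]
    norm_num
  have hsub : Function.support f ⊆ cube x (2 * r) := by
    rw [cube_eq_closedBall x (by positivity)]
    refine hf.trans (Metric.closedBall_subset_closedBall' ?_)
    rw [Metric.mem_closedBall, dist_comm] at hx
    linarith
  -- Doubling the radius makes the cube centered at `x` contain the support of `f`, at the cost of
  -- `2 ^ n` in volume.
  refine le_iSup_of_le (2 * r) (le_iSup_of_le (by positivity) ?_)
  rw [h2r, setLIntegral_eq_of_support_subset (s := cube x (2 * r)) (by
    intro y hy
    exact hsub (by simpa using hy))]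
  calc (2 ^ n)⁻¹ * (V ^ (α / n - 1) * ∫⁻ y, ‖f y‖ₑ)
      = V ^ (α / n) * ((2 ^ n)⁻¹ * V⁻¹ * ∫⁻ y, ‖f y‖ₑ) := by
        rw [ENNReal.rpow_sub _ _ hV0 hVt, ENNReal.rpow_one, div_eq_mul_inv]
        ring
    _ = V ^ (α / n) * ((2 ^ n * V)⁻¹ * ∫⁻ y, ‖f y‖ₑ) := by
        rw [ENNReal.mul_inv (by simp) (by simp)]
    _ ≤ _ := by
        gcongr
        exact le_mul_of_one_le_left' (one_le_pow₀ one_le_two)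

lemma modular_enorm_le (hp : IsExponent p) (hpt : ∀ x ∈ E, p x ≠ ⊤) (hE : MeasurableSet E)
    {f : (Fin n → ℝ) → ℝ} (hs : Function.support f ⊆ E) :
    modular p (fun x => ‖f x‖ₑ) ≤ ∫⁻ x in E, ‖f x‖ₑ ^ (p x).toReal := by
  have hnull : NullMeasurableSet {x | p x = ⊤} volume :=
    hp.aemeasurable.nullMeasurableSet_preimage (measurableSet_singleton ⊤)
  have h1 : ∫⁻ x in {x | p x ≠ ⊤}, ‖f x‖ₑ ^ (p x).toReal ≤
      ∫⁻ x in E, ‖f x‖ₑ ^ (p x).toReal := by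
    rw [← lintegral_indicator hE]
    refine le_trans ?_ (setLIntegral_le_lintegral {x | p x ≠ ⊤} _)
    refine lintegral_mono_ae ?_
    filter_upwards [ae_restrict_mem₀ hnull.compl] with x hx
    by_cases hxE : x ∈ E
    · simp [hxE]
    · have h0 : f x = 0 := by_contra fun h => hxE (hs h)
      have hpos : 0 < (p x).toReal :=
        ENNReal.toReal_pos (zero_lt_one.trans_le (hp.one_le x)).ne' hx
      simp [h0, ENNReal.zero_rpow_of_pos hpos]
  have h2 : essSup (fun x => ‖f x‖ₑ) (volume.restrict {x | p x = ⊤}) ≤ 0 := by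
    refine essSup_le_of_ae_le 0 ?_
    filter_upwards [ae_restrict_mem₀ hnull] with x hx
    have h0 : f x = 0 := by_contra fun h => hpt x (hs h) hx
    simp [h0]
  calc _ ≤ (∫⁻ x in E, ‖f x‖ₑ ^ (p x).toReal) + 0 := add_le_add h1 h2
    _ = _ := add_zero _

lemma setLIntegral_rpow_le_of_strongBounded {T : ((Fin n → ℝ) → ℝ) → (Fin n → ℝ) → ℝ≥0∞}
    {C : ℝ≥0} (hp : IsExponent p)
    (hC : ∀ f, MemVarLp p f → luxNorm q (T f) ≤ C * luxNorm p (fun x => ‖f x‖ₑ))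
    (hpt : ∀ x ∈ E, p x ≠ ⊤) (hqt : ∀ x ∈ E, q x ≠ ⊤) (hE : MeasurableSet E)
    {f : (Fin n → ℝ) → ℝ} (hf : Measurable f) (hs : Function.support f ⊆ E)
    (hm : ∫⁻ x in E, ‖f x‖ₑ ^ (p x).toReal ≤ 1) :
    ∫⁻ x in E, (T f x / (C + 1)) ^ (q x).toReal ≤ 1 := by
  have hmod : modular p (fun x => ‖f x‖ₑ / (1 : ℝ≥0)) ≤ 1 := by
    simpa using (modular_enorm_le hp hpt hE hs).trans hm
  have hnorm : luxNorm p (fun x => ‖f x‖ₑ) ≤ 1 :=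
    iInf_le_of_le 1 (iInf_le_of_le one_pos (iInf_le_of_le hmod (by simp)))
  -- The infimum need not be attained; the strict bound by `C + 1` yields an admissible `c` below
  -- it.
  have hlt : luxNorm q (T f) < C + 1 := by
    calc luxNorm q (T f) ≤ C * luxNorm p (fun x => ‖f x‖ₑ) :=
          hC f ⟨hf.aemeasurable, 1, one_pos, hmod.trans_lt ENNReal.one_lt_top⟩
      _ ≤ C * 1 := by gcongr
      _ < C + 1 := by
        rw [mul_one]
        exact ENNReal.lt_add_right ENNReal.coe_ne_top one_ne_zero
  simp only [luxNorm, iInf_lt_iff] at hlt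
  obtain ⟨c, -, hcm, hcC⟩ := hlt
  calc ∫⁻ x in E, (T f x / (C + 1)) ^ (q x).toReal
      ≤ ∫⁻ x in E, (T f x / c) ^ (q x).toReal := by
        refine lintegral_mono fun x => ?_
        exact ENNReal.rpow_le_rpow (ENNReal.div_le_div_left hcC.le _) ENNReal.toReal_nonneg
    _ ≤ ∫⁻ x in {x | q x ≠ ⊤}, (T f x / c) ^ (q x).toReal := lintegral_mono_set hqt
    _ ≤ modular q (fun x => T f x / c) := le_self_add
    _ ≤ 1 := hcm

lemma card_mul_le_setLIntegral_rpow {S : ℕ → Set (Fin n → ℝ)} {s : ℕ → ℝ≥0∞} {η : ℝ≥0∞} {Q : ℝ}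
    {g : (Fin n → ℝ) → ℝ≥0∞} (I : Finset ℕ) (hS : ∀ i, MeasurableSet (S i))
    (hd : Pairwise (Function.onFun Disjoint S)) (hSE : ∀ i, S i ⊆ E) (hη : η ≤ 1)
    (hq : ∀ x ∈ E, (q x).toReal ≤ Q)
    (h1 : ∀ i ∈ I, 1 ≤ ∫⁻ x in S i, s i ^ (q x).toReal)
    (hg : ∀ i ∈ I, ∀ x ∈ S i, η * s i ≤ g x) :
    I.card * η ^ Q ≤ ∫⁻ x in E, g x ^ (q x).toReal := by
  calc (I.card : ℝ≥0∞) * η ^ Q = ∑ i ∈ I, η ^ Q * 1 := by simp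
    _ ≤ ∑ i ∈ I, ∫⁻ x in S i, g x ^ (q x).toReal := by
        refine Finset.sum_le_sum fun i hi => ?_
        calc η ^ Q * 1 ≤ η ^ Q * ∫⁻ x in S i, s i ^ (q x).toReal := by gcongr; exact h1 i hi
          _ ≤ ∫⁻ x in S i, η ^ Q * s i ^ (q x).toReal := lintegral_const_mul_le _ _
          _ ≤ ∫⁻ x in S i, g x ^ (q x).toReal := by
            refine setLIntegral_mono' (hS i) fun x hx => ?_
            calc η ^ Q * s i ^ (q x).toReal ≤ η ^ (q x).toReal * s i ^ (q x).toReal := by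
                  exact mul_le_mul_left
                    (ENNReal.rpow_le_rpow_of_exponent_ge hη (hq x (hSE i hx))) _
              _ = (η * s i) ^ (q x).toReal :=
                  (ENNReal.mul_rpow_of_nonneg _ _ ENNReal.toReal_nonneg).symm
              _ ≤ _ := ENNReal.rpow_le_rpow (hg i hi x hx) ENNReal.toReal_nonneg
    _ = ∫⁻ x in ⋃ i ∈ I, S i, g x ^ (q x).toReal :=
        (lintegral_biUnion_finset (fun i _ j _ hij => hd hij) (fun i _ => hS i) _).symm
    _ ≤ _ := lintegral_mono_set (iUnion₂_subset fun i _ => hSE i)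

lemma exists_closedBall_density (hE0 : volume E ≠ 0) :
    ∃ x₀ : Fin n → ℝ, ∃ R : ℝ, 0 < R ∧ 2 * R ≤ 1 ∧ ∀ r, 0 < r → r ≤ R →
      3 * volume (Metric.closedBall x₀ r) ≤ 4 * volume (E ∩ Metric.closedBall x₀ r) := by
  have hae := Besicovitch.ae_tendsto_measure_inter_div volume E
  have : (ae (volume.restrict E)).NeBot := by
    rw [ae_neBot]
    simpa using hE0
  obtain ⟨x₀, hx₀⟩ := hae.exists
  have hev := hx₀.eventually (lt_mem_nhds (show (3 / 4 : ℝ≥0∞) < 1 by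
    rw [ENNReal.div_lt_iff (by simp) (by simp)]; norm_num))
  rw [eventually_nhdsWithin_iff, Metric.eventually_nhds_iff] at hev
  obtain ⟨δ, hδ, hev⟩ := hev
  refine ⟨x₀, min (δ / 2) (1 / 2), by positivity, by linarith [min_le_right (δ / 2) (1 / 2)], ?_⟩
  intro r hr hrR
  have h := (hev (y := r) (by
    rw [Real.dist_eq, sub_zero, abs_of_pos hr]
    linarith [hrR.trans (min_le_left _ _)]) hr).le
  rw [ENNReal.le_div_iff_mul_le (.inl (Metric.measure_closedBall_pos _ _ hr).ne')
    (.inl measure_closedBall_lt_top.ne)] at h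
  calc 3 * volume (Metric.closedBall x₀ r)
      = 4 * (3 / 4 * volume (Metric.closedBall x₀ r)) := by
        rw [← mul_assoc, ENNReal.mul_div_cancel (by simp) (by simp)]
    _ ≤ _ := by gcongr

lemma exists_measurableSet_near_one {a ε : ℝ} (hε : 0 < ε)
    (hε' : ε ≤ (1 - a) / 2) (hp : IsExponent p)
    (hpq : ∀ᵐ x ∂(volume : Measure (Fin n → ℝ)), ((p x)⁻¹).toReal - ((q x)⁻¹).toReal = a)
    (hess : essInf p volume ≤ 1) :
    ∃ E : Set (Fin n → ℝ), MeasurableSet E ∧ volume E ≠ 0 ∧ ∀ x ∈ E,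
      p x ≠ ⊤ ∧ q x ≠ ⊤ ∧ 1 ≤ (p x).toReal ∧ (p x).toReal ≤ 1 + ε ∧ 0 < (q x).toReal ∧
      (q x).toReal ≤ 2 / (1 - a) ∧ (p x).toReal⁻¹ = (q x).toReal⁻¹ + a := by
  set F : Set (Fin n → ℝ) := {x | p x < ENNReal.ofReal (1 + ε)} with hF
  have hF0 : volume F ≠ 0 := by
    intro h0
    have : ENNReal.ofReal (1 + ε) ≤ essInf p volume := by
      refine le_essInf_of_ae_le _ ?_
      rw [Filter.EventuallyLE, ae_iff]
      simpa [hF] using h0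
    have := this.trans hess
    rw [ENNReal.ofReal_le_one] at this
    linarith
  have hFn : NullMeasurableSet F volume :=
    hp.aemeasurable.nullMeasurableSet_preimage measurableSet_Iio
  have hGn : NullMeasurableSet (F ∩ {x | ((p x)⁻¹).toReal - ((q x)⁻¹).toReal = a}) volume := by
    refine hFn.inter ?_
    exact NullMeasurableSet.congr nullMeasurableSet_univ
      (Filter.eventuallyEq_univ.2 hpq).symm
  -- The exponents are only a.e. measurable and related a.e., so a genuinely measurable subset is
  -- extracted.
  obtain ⟨E, hEF, hE, hEae⟩ := hGn.exists_measurable_subset_ae_eq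
  refine ⟨E, hE, ?_, fun x hx => ?_⟩
  · rw [measure_congr hEae, measure_inter_conull hpq]
    exact hF0
  · obtain ⟨hxF, hxpq⟩ := hEF hx
    have hpt : p x ≠ ⊤ := (lt_trans hxF ENNReal.ofReal_lt_top).ne
    have hp1 : 1 ≤ (p x).toReal := by
      simpa using ENNReal.toReal_mono hpt (hp.one_le x)
    have hp2 : (p x).toReal ≤ 1 + ε := ENNReal.toReal_le_of_le_ofReal (by linarith) hxF.le
    simp only [mem_ofPred_eq, ENNReal.toReal_inv] at hxpq
    have hpinv : 1 - ε ≤ (p x).toReal⁻¹ := by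
      rw [← one_div, le_div_iff₀ (by linarith)]
      nlinarith
    -- The bound `ε ≤ (1 - a) / 2` keeps `q` bounded independently of `ε`.
    have hqinv : (1 - a) / 2 ≤ (q x).toReal⁻¹ := by linarith
    have hq0 : 0 < (q x).toReal := inv_pos.1 (lt_of_lt_of_le (by linarith) hqinv)
    refine ⟨hpt, fun h => by simp [h] at hq0, hp1, hp2, hq0, ?_, by linarith⟩
    rw [le_inv_comm₀ (by linarith) hq0] at hqinv
    simpa using hqinv

end VarLebesgue

/-! ### Dyadic balls and shells around the density point. -/

namespace VarLebesgue

variable {n : ℕ} {p q : (Fin n → ℝ) → ℝ≥0∞} {E : Set (Fin n → ℝ)}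

/-- The closed ball with center `x₀` and radius `R / 2 ^ i`. -/
def dyadicBall (x₀ : Fin n → ℝ) (R : ℝ) (i : ℕ) : Set (Fin n → ℝ) :=
  Metric.closedBall x₀ (R * (1 / 2) ^ i)

/-- The part of `E` between two consecutive dyadic balls. -/
def dyadicShell (E : Set (Fin n → ℝ)) (x₀ : Fin n → ℝ) (R : ℝ) (i : ℕ) : Set (Fin n → ℝ) :=
  E ∩ (dyadicBall x₀ R i \ dyadicBall x₀ R (i + 1))

variable {x₀ : Fin n → ℝ} {R : ℝ}

lemma measurableSet_dyadicBall (i : ℕ) : MeasurableSet (dyadicBall x₀ R i) :=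
  measurableSet_closedBall

lemma measurableSet_dyadicShell (hE : MeasurableSet E) (i : ℕ) :
    MeasurableSet (dyadicShell E x₀ R i) :=
  hE.inter ((measurableSet_dyadicBall i).diff (measurableSet_dyadicBall (i + 1)))

lemma dyadicBall_antitone (hR : 0 < R) : Antitone (dyadicBall x₀ R) := fun _ _ hij =>
  Metric.closedBall_subset_closedBall (mul_le_mul_of_nonneg_left
    (pow_le_pow_of_le_one (by norm_num) (by norm_num) hij) hR.le)

lemma pairwise_disjoint_dyadicShell (hR : 0 < R) :
    Pairwise (Function.onFun Disjoint (dyadicShell E x₀ R)) := by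
  have key : ∀ i j, i < j → Disjoint (dyadicShell E x₀ R i) (dyadicShell E x₀ R j) := by
    intro i j hij
    refine Set.disjoint_left.2 fun x hx hx' => hx.2.2 ?_
    exact dyadicBall_antitone hR hij hx'.2.1
  intro i j hij
  rcases hij.lt_or_gt with h | h
  · exact key i j h
  · exact (key j i h).symm

lemma volume_dyadicBall (hR : 0 < R) (i : ℕ) :
    volume (dyadicBall x₀ R i) = ENNReal.ofReal ((2 * R) ^ n * ((1 / 2) ^ n) ^ i) := by
  rw [dyadicBall, Real.volume_pi_closedBall _ (by positivity), Fintype.card_fin]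
  congr 1
  rw [← mul_assoc, mul_pow, ← pow_mul, ← pow_mul, mul_comm i n]

lemma volume_dyadicBall_ne_zero (hR : 0 < R) (i : ℕ) : volume (dyadicBall x₀ R i) ≠ 0 :=
  (Metric.measure_closedBall_pos _ _ (by positivity)).ne'

lemma volume_dyadicBall_ne_top (i : ℕ) : volume (dyadicBall x₀ R i) ≠ ⊤ :=
  measure_closedBall_lt_top.ne

lemma two_mul_volume_dyadicBall_succ_le (hn : n ≠ 0) (hR : 0 < R) (i : ℕ) :
    2 * volume (dyadicBall x₀ R (i + 1)) ≤ volume (dyadicBall x₀ R i) := by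
  rw [volume_dyadicBall hR, volume_dyadicBall hR, ← ENNReal.ofReal_ofNat 2,
    ← ENNReal.ofReal_mul (by norm_num)]
  refine ENNReal.ofReal_le_ofReal ?_
  have h : ((1 : ℝ) / 2) ^ n ≤ 1 / 2 := pow_le_of_le_one (by norm_num) (by norm_num) hn
  have h' : (0 : ℝ) ≤ (2 * R) ^ n * ((1 / 2) ^ n) ^ i := by positivity
  rw [pow_succ]
  nlinarith

/-- `E` fills `3/4` of the ball and the next ball takes at most `1/2`, which leaves `1/4`. -/
lemma volume_dyadicBall_le_four_mul (hn : n ≠ 0) (hR : 0 < R) {i : ℕ}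
    (hd : 3 * volume (dyadicBall x₀ R i) ≤ 4 * volume (E ∩ dyadicBall x₀ R i)) :
    volume (dyadicBall x₀ R i) ≤ 4 * volume (dyadicShell E x₀ R i) := by
  have h1 : volume (E ∩ dyadicBall x₀ R i) ≤
      volume (dyadicShell E x₀ R i) + volume (dyadicBall x₀ R (i + 1)) := by
    refine (measure_mono ?_).trans (measure_union_le _ _)
    intro x hx
    by_cases h : x ∈ dyadicBall x₀ R (i + 1)
    · exact .inr h
    · exact .inl ⟨hx.1, hx.2, h⟩
  have h2 : 2 * volume (dyadicBall x₀ R i) + volume (dyadicBall x₀ R i) ≤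
      2 * volume (dyadicBall x₀ R i) + 4 * volume (dyadicShell E x₀ R i) := by
    calc _ = 3 * volume (dyadicBall x₀ R i) := by ring
      _ ≤ 4 * (volume (dyadicShell E x₀ R i) + volume (dyadicBall x₀ R (i + 1))) :=
          hd.trans (by gcongr)
      _ = 2 * (2 * volume (dyadicBall x₀ R (i + 1))) + 4 * volume (dyadicShell E x₀ R i) := by
          ring
      _ ≤ _ := by gcongr; exact two_mul_volume_dyadicBall_succ_le hn hR i
  exact ENNReal.le_of_add_le_add_left
    (ENNReal.mul_ne_top (by simp) (volume_dyadicBall_ne_top i)) h2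

/-- The masses `massSup` of the dyadic balls decay slowly along some block of `N` scales. -/
lemma exists_massSup_le_two_mul {ε : ℝ} {N : ℕ} (hR : 0 < R) (hR1 : 2 * R ≤ 1) (hε : 0 < ε)
    (hN : n * N * ε < 1) (hE : MeasurableSet E)
    (hp : ∀ x ∈ E, 1 ≤ (p x).toReal) (hp' : ∀ x ∈ E, (p x).toReal ≤ 1 + ε)
    (hd : ∀ i, 3 * volume (dyadicBall x₀ R i) ≤ 4 * volume (E ∩ dyadicBall x₀ R i)) :
    ∃ j, massSup p E (E ∩ dyadicBall x₀ R j) ≤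
      2 * massSup p E (E ∩ dyadicBall x₀ R (j + N)) := by
  set T : ℕ → ℝ≥0∞ := fun i => massSup p E (E ∩ dyadicBall x₀ R i) with hT
  have hmeas : ∀ i, MeasurableSet (E ∩ dyadicBall x₀ R i) := fun i =>
    hE.inter (measurableSet_dyadicBall i)
  have hfin : ∀ i, volume (E ∩ dyadicBall x₀ R i) ≠ ⊤ := fun i =>
    measure_ne_top_of_subset inter_subset_right (volume_dyadicBall_ne_top i)
  have hTt : ∀ i, T i ≠ ⊤ := fun i =>
    ne_top_of_le_ne_top (by simp [hfin i]) (massSup_le inter_subset_left (hmeas i) hp)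
  have hV1 : ∀ i, volume (dyadicBall x₀ R i) ≤ 1 := by
    intro i
    rw [volume_dyadicBall hR, ENNReal.ofReal_le_one]
    exact mul_le_one₀ (pow_le_one₀ (by positivity) hR1) (by positivity)
      (pow_le_one₀ (by positivity) (pow_le_one₀ (by norm_num) (by norm_num)))
  have hlow : ∀ i, ENNReal.ofReal ((2 * R) ^ n / 2 * ((1 / 2) ^ n) ^ i) ≤
      volume (E ∩ dyadicBall x₀ R i) := by
    intro i
    have h4 : ENNReal.ofReal 4 * ENNReal.ofReal ((2 * R) ^ n / 2 * ((1 / 2) ^ n) ^ i) ≤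
        4 * volume (E ∩ dyadicBall x₀ R i) := by
      refine le_trans ?_ (hd i)
      rw [volume_dyadicBall hR, ← ENNReal.ofReal_ofNat 3, ← ENNReal.ofReal_mul (by norm_num),
        ← ENNReal.ofReal_mul (by norm_num)]
      refine ENNReal.ofReal_le_ofReal ?_
      have h' : (0 : ℝ) ≤ (2 * R) ^ n * ((1 / 2) ^ n) ^ i := by positivity
      linarith
    rwa [ENNReal.ofReal_ofNat, ENNReal.mul_le_mul_iff_right (by simp) (by simp)] at h4
  have hTlow : ∀ i, ((2 * R) ^ n / 2 * ((1 / 2) ^ n) ^ i) ^ ε ≤ (T i).toReal := by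
    intro i
    have hpos : (0 : ℝ) < (2 * R) ^ n / 2 * ((1 / 2) ^ n) ^ i := by positivity
    rw [← ENNReal.ofReal_le_iff_le_toReal (hTt i), ← ENNReal.ofReal_rpow_of_pos hpos]
    refine (ENNReal.rpow_le_rpow (hlow i) hε.le).trans ?_
    exact rpow_volume_le_massSup hε inter_subset_left (hmeas i) hE hp hp'
      ((ENNReal.ofReal_pos.2 hpos).trans_le (hlow i)).ne'
      ((measure_mono inter_subset_right).trans (hV1 i))
  -- Over `N` scales the lower bound for the masses shrinks by this ratio; being above `1/2`, it
  -- rules out perpetual halving.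
  have hρ : (1 : ℝ) / 2 < (1 / 2) ^ (n * N * ε) := by
    conv_lhs => rw [← Real.rpow_one (1 / 2)]
    exact Real.rpow_lt_rpow_of_exponent_gt (by norm_num) (by norm_num) hN
  obtain ⟨k, hk⟩ := exists_half_le_succ (t := fun k => (T (N * k)).toReal)
    (κ := ((2 * R) ^ n / 2) ^ ε) (by positivity) hρ (by
      intro k
      refine le_trans (le_of_eq ?_) (hTlow (N * k))
      rw [Real.mul_rpow (by positivity) (by positivity)]
      congr 1
      rw [← pow_mul, ← Real.rpow_natCast, ← Real.rpow_natCast, ← Real.rpow_mul (by norm_num),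
        ← Real.rpow_mul (by norm_num)]
      congr 1
      push_cast
      ring)
  refine ⟨N * k, ?_⟩
  change T (N * k) ≤ 2 * T (N * k + N)
  rw [← ENNReal.toReal_le_toReal (hTt _) (ENNReal.mul_ne_top (by simp) (hTt _)),
    ENNReal.toReal_mul]
  simp only [mul_add, mul_one] at hk
  simp only [ENNReal.toReal_ofNat]
  linarith

end VarLebesgue

/-! ### The contradiction. -/

open VarLebesgue in
theorem mainTheorem1 (n : ℕ) (α : ℝ) (hα0 : 0 ≤ α) (hαn : α < n)
    (p q : (Fin n → ℝ) → ℝ≥0∞)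
    (hp : VarLebesgue.IsExponent p) (hq : VarLebesgue.IsExponent q)
    (hpq : ∀ᵐ x ∂(volume : Measure (Fin n → ℝ)),
      ((p x)⁻¹).toReal - ((q x)⁻¹).toReal = α / n)
    (hM : VarLebesgue.StrongBounded p q (VarLebesgue.fracMaximal α)) :
    1 < essInf p volume := by
  by_contra! hess
  obtain ⟨C, hC⟩ := hM
  have hn0 : (0 : ℝ) < n := hα0.trans_lt hαn
  have hn : n ≠ 0 := by rintro rfl; simp at hn0
  have ha0 : 0 ≤ α / n := by positivity
  have ha1 : α / n < 1 := (div_lt_one hn0).2 hαn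
  -- Losses: `2 ^ n` from the doubled cube, `4` from the mass of `f` against `T i`, `9` from the
  -- shell bound, `C + 1` from the norm inequality. As `η` does not involve `ε`, `N` can be fixed
  -- before `ε`.
  set η : ℝ≥0∞ := (2 ^ n)⁻¹ * (4⁻¹ * 9⁻¹ * (C + 1 : ℝ≥0∞)⁻¹) with hη
  have hη0 : η ≠ 0 := by simp [hη]
  have hη1 : η ≤ 1 := by
    refine mul_le_one' (ENNReal.inv_le_one.2 (one_le_pow₀ one_le_two)) (mul_le_one'
      (mul_le_one' (ENNReal.inv_le_one.2 (by norm_num)) (ENNReal.inv_le_one.2 (by norm_num)))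
      (ENNReal.inv_le_one.2 (by simp)))
  have hηt : η ≠ ⊤ := ne_top_of_le_ne_top ENNReal.one_ne_top hη1
  obtain ⟨N, hN⟩ := ENNReal.exists_nat_mul_gt (a := η ^ (2 / (1 - α / n))) (b := 1)
    (ENNReal.rpow_pos hη0.bot_lt hηt).ne' ENNReal.one_ne_top
  set ε : ℝ := min ((1 - α / n) / 2) (1 / (n * N + 1)) with hεdef
  have hε : 0 < ε := lt_min (by linarith) (by positivity)
  have hNε : n * N * ε < 1 := by
    calc n * N * ε ≤ n * N * (1 / (n * N + 1)) := by gcongr; exact min_le_right _ _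
      _ < 1 := by rw [mul_one_div, div_lt_one (by positivity)]; linarith
  obtain ⟨E, hE, hE0, hprop⟩ :=
    exists_measurableSet_near_one hε (min_le_left _ _) hp hpq hess
  choose hpt hqt hp1 hp2 hq0 hq1 hpqE using hprop
  obtain ⟨x₀, R, hR, hR1, hdens⟩ := exists_closedBall_density hE0
  have hd : ∀ i, 3 * volume (dyadicBall x₀ R i) ≤ 4 * volume (E ∩ dyadicBall x₀ R i) :=
    fun i => hdens _ (by positivity)
      (mul_le_of_le_one_right hR.le (pow_le_one₀ (by norm_num) (by norm_num)))
  obtain ⟨j, hj⟩ := exists_massSup_le_two_mul hR hR1 hε hNε hE hp1 hp2 hd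
  set T : ℕ → ℝ≥0∞ := fun i => massSup p E (E ∩ dyadicBall x₀ R i) with hTdef
  have hmeas : ∀ i, MeasurableSet (E ∩ dyadicBall x₀ R i) := fun i =>
    hE.inter (measurableSet_dyadicBall i)
  have hfin : ∀ i, volume (E ∩ dyadicBall x₀ R i) ≠ ⊤ := fun i =>
    measure_ne_top_of_subset inter_subset_right (volume_dyadicBall_ne_top i)
  have hT0 : ∀ i, T i ≠ 0 := fun i => by
    refine massSup_ne_zero inter_subset_left (hmeas i) hE hp1 (fun h0 => ?_) (hfin i)
    have := hd i
    rw [h0] at this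
    simp [volume_dyadicBall_ne_zero hR i] at this
  have hTt : ∀ i, T i ≠ ⊤ := fun i =>
    ne_top_of_le_ne_top (by simp [hfin i]) (massSup_le inter_subset_left (hmeas i) hp1)
  -- The supremum need not be attained, so `f` is chosen with more than half of the extremal mass.
  have hlt : 2⁻¹ * T (j + N) < T (j + N) := by
    rw [mul_comm, ← div_eq_mul_inv]
    exact ENNReal.half_lt_self (hT0 _) (hTt _)
  obtain ⟨f, hf, hfs, hfm, hfT⟩ := exists_of_lt_massSup hlt
  have hupper := setLIntegral_rpow_le_of_strongBounded hp hC hpt hqt hE hf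
    (hfs.trans inter_subset_left) hfm
  refine absurd (hN.trans_le ?_) (lt_irrefl (1 : ℝ≥0∞))
  refine le_trans ?_ hupper
  have hlower := card_mul_le_setLIntegral_rpow (q := q) (S := dyadicShell E x₀ R)
    (s := fun i => 9 * (volume (dyadicBall x₀ R i) ^ (α / n - 1) * T i)) (η := η)
    (g := fun x => fracMaximal α f x / (C + 1)) (Finset.Ico j (j + N))
    (measurableSet_dyadicShell hE) (pairwise_disjoint_dyadicShell hR)
    (fun i => inter_subset_left) hη1 hq1 ?_ ?_
  · simpa using hlower
  · intro i _
    exact one_le_setLIntegral_rpow ha0 inter_subset_left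
      (inter_subset_inter_right E sdiff_subset) inter_subset_left
      (measurableSet_dyadicShell hE i) (hmeas i) hE hp1 hq0 hpqE
      (volume_dyadicBall_ne_zero hR i) (volume_dyadicBall_ne_top i)
      (measure_mono (inter_subset_right.trans sdiff_subset))
      (volume_dyadicBall_le_four_mul hn hR (hd i)) (hfin i) (hT0 i)
  · intro i hi x hx
    rw [Finset.mem_Ico] at hi
    have hmono : ∀ k l, k ≤ l → T l ≤ T k := fun k l hkl =>
      massSup_mono (inter_subset_inter_right E (dyadicBall_antitone hR hkl))
    have hmass : 4⁻¹ * T i ≤ ∫⁻ y, ‖f y‖ₑ := by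
      calc 4⁻¹ * T i ≤ 4⁻¹ * (2 * T (j + N)) := by
            gcongr; exact (hmono j i hi.1).trans hj
        _ = 2⁻¹ * T (j + N) := by
            rw [← mul_assoc, show (4 : ℝ≥0∞) = 2 * 2 by norm_num,
              ENNReal.mul_inv (by simp) (by simp), mul_assoc 2⁻¹,
              ENNReal.inv_mul_cancel (by simp) (by simp), mul_one]
        _ ≤ _ := hfT.le
    have hmax := le_fracMaximal (f := f) hα0 (r := R * (1 / 2) ^ i) (by positivity) hx.2.1
      (hfs.trans (inter_subset_right.trans (dyadicBall_antitone hR hi.2.le)))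
    calc η * (9 * (volume (dyadicBall x₀ R i) ^ (α / n - 1) * T i))
        = (2 ^ n)⁻¹ * (volume (dyadicBall x₀ R i) ^ (α / n - 1) * (4⁻¹ * T i)) *
            (C + 1 : ℝ≥0∞)⁻¹ * (9⁻¹ * 9) := by rw [hη]; ring
      _ = (2 ^ n)⁻¹ * (volume (dyadicBall x₀ R i) ^ (α / n - 1) * (4⁻¹ * T i)) *
            (C + 1 : ℝ≥0∞)⁻¹ := by
          rw [ENNReal.inv_mul_cancel (by simp) (by simp), mul_one]
      _ ≤ (2 ^ n)⁻¹ * (volume (dyadicBall x₀ R i) ^ (α / n - 1) * ∫⁻ y, ‖f y‖ₑ) *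
            (C + 1 : ℝ≥0∞)⁻¹ := by gcongr
      _ ≤ fracMaximal α f x / (C + 1) := by
          rw [div_eq_mul_inv]
          exact mul_le_mul_left hmax _
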